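/- Let $\Phi$ be an irreducible simply laced root system, normalised so that $(\alpha,\alpha)=2$ for all roots, let $\Delta\subseteq\Phi$ be a subsystem, and let $R$ be a commutative ring with unity. Assume condition $(*)$: - no subsystem $\Phi'=\{\pm\gamma\}$ of $\Phi$ satisfies both $\Delta\cap\Phi'=\varnothing$ and $\Delta\perp\Phi'$; - no subsystem $\Phi'\subseteq\Phi$ of type $A_2$ is such that $\Delta'=\Delta\cap\Phi'$ has type $A_1$ and every root of $\Delta\setminus\Delta'$ is orthogonal to $\Phi'$. Let $L(\Phi,\mathbb Z)$ be the integer span of a Chevalley basis $\{h_i\}\cup\{e_\alpha\}_{\alpha\in\Phi}$ of the complex simple Lie algebra of type $\Phi$. Let $L(\Phi,R)=L(\Phi,\mathbb Z)\otimes_{\mathbb Z}R$ be the Chevalley algebra, let $D=\sum_i R\,h_i$, and let $L'(\Delta,R)\le L(\Phi,R)$ be the $R$-subalgebra generated by all $e_\alpha$ with $\alpha\in\Delta$. Roots $\gamma_1,\gamma_2\in\Phi$ are called equivalent if $(\gamma_1,\alpha)=(\gamma_2,\alpha)$ for all $\alpha\in\Delta$. The equivalence class $[\gamma]$ of $\gamma$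 is called a block, and we put $([\gamma],\alpha)=(\gamma,\alpha)$ for $\alpha\in\Delta$ and $M_{[\gamma]}=\bigoplus_{\gamma'\in[\gamma]}R\,e_{\gamma'}$. An $R$-overalgebra is an $R$-Lie subalgebra $L$ with $L'(\Delta,R)\le L\le L(\Phi,R)$. Its level is the collection $\mathrm{lev}(L)=\{\mathrm{lev}(L)_{[\gamma]}\}$ with $\mathrm{lev}(L)_{[\gamma]}=M_{[\gamma]}\cap L$. A prelevel is a collection $\sigma=\{\sigma_{[\gamma]}\}$ of $R$-submodules $\sigma_{[\gamma]}\le M_{[\gamma]}$, indexed by the blocks, such that $\sigma_{[\gamma+\alpha]}=[e_\alpha,\sigma_{[\gamma]}]$ whenever $\alpha\in\Delta$ and $([\gamma],\alpha)=-1$, and $\sigma_{[\alpha]}=M_{[\alpha]}$ for all $\alpha\in\Delta$. A prelevel is called an almost level if it is the level of some $R$-overalgebra. Let $\sigma$ be an almost level. Then: 1. Among all $R$-overalgebras of level $\sigma$ there exist, with respect to inclusion, a smallest one $L_{\min}(\sigma)$ and a largest one $L_{\max}(\sigma)$. 2. For every $R$-overalgebra $L$ of level $\sigma$, the algebra $L_{\max}(\sigma)$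 is the normalizer of $L$: $L_{\max}(\sigma)=\{v\in L(\Phi,R)\mid [v,L]\subseteq L\}$. Moreover, every $R$-overalgebra $L$ (of any level) has the direct sum decomposition $L=(D\cap L)\oplus\bigoplus_{[\gamma]}\mathrm{lev}(L)_{[\gamma]}$. -/

import Mathlib

open scoped TensorProduct

noncomputable section

namespace Chevalley

section RootSystems

variable {ι K V W : Type*} [Field K] [CharZero K] [AddCommGroup V] [Module K V]
  [AddCommGroup W] [Module K W] (P : RootPairing ι K V W)

/-- The index of the root `-γ`. -/
abbrev negRoot (γ : ι) : ι := P.reflectionPerm γ γ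

variable [P.IsCrystallographic]

/-- A (reduced, crystallographic) root system is simply laced if any two non-proportional roots
have pairing `-1`, `0` or `1`. Then, for the invariant form with `(α, α) = 2` for all roots, the
inner product `(α, β)` is the integer `P.pairingIn ℤ α β`. -/
class IsSimplyLaced : Prop where
  pairingIn_mem : ∀ α β : ι, α ≠ β → α ≠ negRoot P β →
    P.pairingIn ℤ α β = -1 ∨ P.pairingIn ℤ α β = 0 ∨ P.pairingIn ℤ α β = 1

/-- A set of roots is a subsystem if it is stable under the reflections in its members. -/
def IsSubsystem (Δ : Set ι) : Prop :=
  ∀ α ∈ Δ, ∀ β ∈ Δ, P.reflectionPerm α β ∈ Δ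

/-- The subsystems `{γ, -γ}` of type `A₁`. -/
def IsTypeA1 (Ψ : Set ι) : Prop :=
  ∃ γ : ι, Ψ = {γ, negRoot P γ}

/-- The subsystems `{±α, ±β, ±(α + β)}` of type `A₂`; here `α + β` is the image of `β` under the
reflection in `α`. -/
def IsTypeA2 (Ψ : Set ι) : Prop :=
  ∃ α β : ι, P.pairingIn ℤ α β = -1 ∧ P.pairingIn ℤ β α = -1 ∧
    Ψ = {α, negRoot P α, β, negRoot P β,
      P.reflectionPerm α β, negRoot P (P.reflectionPerm α β)}

/-- For a subsystem `Φ'` of the root system and a subset `Δ'`: the problem for `Δ` includes the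
problem for `Δ' ≤ Φ'`, that is, `Δ ∩ Φ' = Δ'` and the roots in `Δ ∖ Δ'` are orthogonal
to `Φ'`. -/
def IncludesProblem (Δ Δ' Φ' : Set ι) : Prop :=
  Δ ∩ Φ' = Δ' ∧ ∀ α ∈ Δ \ Δ', ∀ γ ∈ Φ', P.pairingIn ℤ α γ = 0

/-- The problem for `Δ` includes neither a problem of type `∅ ≤ A₁` nor one of type
`A₁ ≤ A₂`. -/
def ConditionStar (Δ : Set ι) : Prop :=
  (∀ Φ' : Set ι, IsTypeA1 P Φ' → ¬ IncludesProblem P Δ ∅ Φ') ∧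
  (∀ Δ' Φ' : Set ι, IsTypeA1 P Δ' → IsTypeA2 P Φ' → ¬ IncludesProblem P Δ Δ' Φ')

/-- Roots are equivalent if they have the same inner products with all roots in `Δ`. -/
def blockSetoid (Δ : Set ι) : Setoid ι where
  r γ₁ γ₂ := ∀ α ∈ Δ, P.pairingIn ℤ γ₁ α = P.pairingIn ℤ γ₂ α
  iseqv :=
    ⟨fun _ _ _ => rfl, fun h α hα => (h α hα).symm, fun h h' α hα => (h α hα).trans (h' α hα)⟩

/-- Blocks: equivalence classes of roots. -/
abbrev Block (Δ : Set ι) : Type _ := Quotient (blockSetoid P Δ)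

/-- The block `[γ]`. -/
def block (Δ : Set ι) (γ : ι) : Block P Δ := Quotient.mk (blockSetoid P Δ) γ

end RootSystems

section ChevalleyBases

open LieAlgebra LieAlgebra.IsKilling

variable {𝔤 : Type*} [LieRing 𝔤] [LieAlgebra ℂ 𝔤] [FiniteDimensional ℂ 𝔤]
  [LieAlgebra.IsKilling ℂ 𝔤] (H : LieSubalgebra ℂ 𝔤) [H.IsCartanSubalgebra]

/-- A Chevalley basis of the complex semisimple Lie algebra `𝔤` with respect to the Cartan
subalgebra `H`: root vectors `e α` for all roots and the coroots `h_i` of a base of the root system,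
such that `[e_α, e_{-α}]` is the coroot of `α`, and such that
`[e_α, e_β] = c e_{α+β}` implies `[e_{-α}, e_{-β}] = -c e_{-α-β}`. -/
structure ChevalleyBasis where
  base : (rootSystem H).Base
  e : H.root → 𝔤
  e_mem : ∀ α : H.root, e α ∈ rootSpace H (α : LieModule.Weight ℂ H 𝔤)
  lie_e_e_neg : ∀ α : H.root, ⁅e α, e (negRoot (rootSystem H) α)⁆ = ((rootSystem H).coroot α : 𝔤)
  lie_e_neg_e_neg : ∀ α β γ : H.root,
    (rootSystem H).root γ = (rootSystem H).root α + (rootSystem H).root β →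
    ∀ c : ℂ, ⁅e α, e β⁆ = c • e γ →
      ⁅e (negRoot (rootSystem H) α), e (negRoot (rootSystem H) β)⁆ =
        -(c • e (negRoot (rootSystem H) γ))

variable {H}

namespace ChevalleyBasis

variable (B : ChevalleyBasis H)

/-- The element `h_i` of the Chevalley basis: the coroot of the simple root `i`. -/
def h (i : B.base.support) : 𝔤 := ((rootSystem H).coroot i : 𝔤)

lemma root_negRoot (α : H.root) :
    (rootSystem H).root (negRoot (rootSystem H) α) = -(rootSystem H).root α := by
  rw [RootPairing.root_reflectionPerm, RootPairing.reflection_apply_self]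

lemma negRoot_negRoot (α : H.root) :
    negRoot (rootSystem H) (negRoot (rootSystem H) α) = α := by
  apply (rootSystem H).root.injective
  rw [root_negRoot, root_negRoot, neg_neg]

lemma lie_h_e (α β : H.root) :
    ⁅((rootSystem H).coroot α : 𝔤), B.e β⁆ = (rootSystem H).pairingIn ℤ β α • B.e β := by
  have h1 := lie_eq_smul_of_mem_rootSpace (B.e_mem β) ((rootSystem H).coroot α)
  have h2 : (((rootSystem H).pairingIn ℤ β α : ℤ) : ℂ) = (rootSystem H).pairing β α := by
    simpa using (rootSystem H).algebraMap_pairingIn ℤ β α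
  rw [← Int.cast_smul_eq_zsmul ℂ, h2]
  exact h1

lemma e_ne_zero (α : H.root) : B.e α ≠ 0 := by
  intro h0
  have h1 := B.lie_e_e_neg α
  rw [h0, zero_lie] at h1
  exact (rootSystem H).ne_zero' α (Subtype.ext h1.symm)

/-- Brackets of root vectors vanish if the sum of the roots is neither zero nor a root. -/
lemma lie_e_e_eq_zero (α β : H.root) (h0 : (rootSystem H).root α + (rootSystem H).root β ≠ 0)
    (h1 : ∀ γ, (rootSystem H).root γ ≠ (rootSystem H).root α + (rootSystem H).root β) :
    ⁅B.e α, B.e β⁆ = 0 := by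
  have hm := lie_mem_genWeightSpace_of_mem_genWeightSpace (B.e_mem α) (B.e_mem β)
  by_contra hne
  have hbot : rootSpace H ((α : LieModule.Weight ℂ H 𝔤) + (β : LieModule.Weight ℂ H 𝔤) : H → ℂ)
      ≠ ⊥ := fun h => hne (by simpa [h] using hm)
  let χ : LieModule.Weight ℂ H 𝔤 := ⟨_, hbot⟩
  have hχ : χ.IsNonZero := by
    intro hz
    apply h0
    ext x
    exact congrFun hz x
  refine h1 ⟨χ, by simpa using hχ⟩ ?_
  ext x
  rfl

lemma exists_lie_e_e (α β γ : H.root)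
    (hγ : (rootSystem H).root γ = (rootSystem H).root α + (rootSystem H).root β) :
    ∃ c : ℂ, ⁅B.e α, B.e β⁆ = c • B.e γ := by
  have hm := lie_mem_genWeightSpace_of_mem_genWeightSpace (B.e_mem α) (B.e_mem β)
  have hw : ((α : LieModule.Weight ℂ H 𝔤) + (β : LieModule.Weight ℂ H 𝔤) : H → ℂ)
      = (γ : LieModule.Weight ℂ H 𝔤) := by
    ext x
    exact (DFunLike.congr_fun hγ x).symm
  rw [hw] at hm
  have hfin := finrank_rootSpace_eq_one (γ : LieModule.Weight ℂ H 𝔤)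
    (H.isNonZero_coe_root γ)
  obtain ⟨c, hc⟩ := (finrank_eq_one_iff_of_nonzero'
    (⟨B.e γ, B.e_mem γ⟩ : rootSpace H (γ : LieModule.Weight ℂ H 𝔤))
    (fun h0 => B.e_ne_zero γ (congrArg Subtype.val h0))).1 hfin ⟨_, hm⟩
  exact ⟨c, (congrArg Subtype.val hc).symm⟩

variable [IsSimplyLaced (rootSystem H)]

lemma pairingIn_eq_neg_one (α β γ : H.root)
    (hγ : (rootSystem H).root γ = (rootSystem H).root α + (rootSystem H).root β) :
    (rootSystem H).pairingIn ℤ β α = -1 := by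
  have hsum : (rootSystem H).pairingIn ℤ γ α = 2 + (rootSystem H).pairingIn ℤ β α := by
    have := RootPairing.pairing_eq_add_of_root_eq_add (l := α) hγ
    rw [RootPairing.pairing_same] at this
    have h2 : ∀ x, (rootSystem H).pairing x α = (((rootSystem H).pairingIn ℤ x α : ℤ) : ℂ) :=
      fun x => by simpa using ((rootSystem H).algebraMap_pairingIn ℤ x α).symm
    rw [h2, h2] at this
    exact_mod_cast this
  have hβ : β ≠ negRoot (rootSystem H) α := by
    rintro rfl
    rw [root_negRoot, add_neg_cancel] at hγ
    exact (rootSystem H).ne_zero _ hγ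
  have hγα : γ ≠ α := by
    rintro rfl
    exact (rootSystem H).ne_zero β (left_eq_add.1 hγ)
  have hβα : β ≠ α := by
    rintro rfl
    have h4 : (rootSystem H).pairingIn ℤ β β = 2 := by simp
    by_cases hn : γ = negRoot (rootSystem H) β
    · rw [hn, root_negRoot] at hγ
      have h3 : (3 : ℂ) • (rootSystem H).root β = 0 := by
        have : (3 : ℂ) • (rootSystem H).root β
          = ((rootSystem H).root β + (rootSystem H).root β) + (rootSystem H).root β := by module
        rw [this, ← hγ, neg_add_cancel]
      exact (rootSystem H).ne_zero β ((smul_eq_zero.1 h3).resolve_left (by norm_num))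
    · rcases IsSimplyLaced.pairingIn_mem (P := rootSystem H) γ β hγα hn with h | h | h <;> omega
  have h5 := IsSimplyLaced.pairingIn_mem (P := rootSystem H) β α hβα hβ
  by_cases hn : γ = negRoot (rootSystem H) α
  · have : (rootSystem H).pairingIn ℤ γ α = -2 := by
      have h6 := (rootSystem H).algebraMap_pairingIn ℤ γ α
      rw [hn, RootPairing.pairing_reflectionPerm_self_left, RootPairing.pairing_same] at h6
      rw [hn]
      simp
    omega
  · have := IsSimplyLaced.pairingIn_mem (P := rootSystem H) γ α hγα hn
    omega

lemma coroot_add (α β γ : H.root)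
    (hγ : (rootSystem H).root γ = (rootSystem H).root α + (rootSystem H).root β) :
    (rootSystem H).coroot γ = (rootSystem H).coroot α + (rootSystem H).coroot β := by
  have h2 : ∀ x y, (rootSystem H).pairing x y = (((rootSystem H).pairingIn ℤ x y : ℤ) : ℂ) :=
    fun x y => by simpa using ((rootSystem H).algebraMap_pairingIn ℤ x y).symm
  have h3 : (rootSystem H).root γ = (rootSystem H).reflection α ((rootSystem H).root β) := by
    rw [RootPairing.reflection_apply_root, h2, pairingIn_eq_neg_one α β γ hγ, hγ]
    push_cast
    module
  rw [(rootSystem H).coroot_eq_coreflection_of_root_eq h3,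
    RootPairing.coreflection_apply_coroot, h2,
    pairingIn_eq_neg_one β α γ (by rw [hγ, add_comm])]
  push_cast
  module

/-- In the simply laced case the structure constants are `±1`. -/
lemma lie_e_e_eq_or (α β γ : H.root)
    (hγ : (rootSystem H).root γ = (rootSystem H).root α + (rootSystem H).root β) :
    ⁅B.e α, B.e β⁆ = B.e γ ∨ ⁅B.e α, B.e β⁆ = -B.e γ := by
  set nα := negRoot (rootSystem H) α with hnα
  set nβ := negRoot (rootSystem H) β with hnβ
  set nγ := negRoot (rootSystem H) γ with hnγ
  have rα : (rootSystem H).root nα = -(rootSystem H).root α := root_negRoot α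
  have rβ : (rootSystem H).root nβ = -(rootSystem H).root β := root_negRoot β
  have rγ : (rootSystem H).root nγ = -(rootSystem H).root γ := root_negRoot γ
  obtain ⟨c, hc⟩ := B.exists_lie_e_e α β γ hγ
  obtain ⟨a, ha⟩ := B.exists_lie_e_e nγ α nβ (by rw [rγ, rβ, hγ]; abel)
  obtain ⟨b, hb⟩ := B.exists_lie_e_e nγ β nα (by rw [rγ, rα, hγ]; abel)
  have tα := B.lie_e_e_neg α
  have tβ := B.lie_e_e_neg β
  have tγ := B.lie_e_e_neg γ
  rw [← hnα] at tα
  rw [← hnβ] at tβ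
  rw [← hnγ] at tγ
  have hpβα := pairingIn_eq_neg_one α β γ hγ
  have hind : LinearIndependent ℂ ![(rootSystem H).coroot α, (rootSystem H).coroot β] := by
    have h2 : ∀ x y, (rootSystem H).pairing x y = (((rootSystem H).pairingIn ℤ x y : ℤ) : ℂ) :=
      fun x y => by simpa using ((rootSystem H).algebraMap_pairingIn ℤ x y).symm
    have hpαβ := pairingIn_eq_neg_one β α γ (by rw [hγ, add_comm])
    rw [LinearIndependent.pair_iff]
    intro s t hst
    have e1 := congrArg ((rootSystem H).root' α) hst
    have e2 := congrArg ((rootSystem H).root' β) hst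
    simp only [map_add, map_smul, RootPairing.root'_coroot_eq_pairing, RootPairing.pairing_same,
      h2, hpαβ, hpβα, map_zero, smul_eq_mul] at e1 e2
    push_cast at e1 e2
    constructor
    · linear_combination (2 / 3 : ℂ) * e1 + (1 / 3 : ℂ) * e2
    · linear_combination (1 / 3 : ℂ) * e1 + (2 / 3 : ℂ) * e2
  have hac : a = c := by
    have J := leibniz_lie (B.e nγ) (B.e α) (B.e β)
    rw [hc, ha, hb, lie_smul, smul_lie, lie_smul, ← lie_skew (B.e nγ), tγ,
      ← lie_skew (B.e nβ), tβ, tα, coroot_add α β γ hγ] at J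
    have J' : (c + b) • (rootSystem H).coroot α + (c - a) • (rootSystem H).coroot β = 0 := by
      apply Subtype.ext
      push_cast at J ⊢
      linear_combination (norm := module) (-1 : ℂ) • J
    have := (LinearIndependent.pair_iff.1 hind _ _ J').2
    linear_combination -this
  have hd := B.lie_e_neg_e_neg nγ α nβ (by rw [rγ, rβ, hγ]; abel) a ha
  rw [negRoot_negRoot, negRoot_negRoot, ← hnα, hac] at hd
  have hzero : ⁅B.e β, B.e nα⁆ = 0 := by
    refine B.lie_e_e_eq_zero β nα ?_ ?_
    · intro h0
      have : (rootSystem H).root β = (rootSystem H).root α := by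
        rw [rα] at h0
        exact add_neg_eq_zero.1 h0
      have := (rootSystem H).root.injective this
      subst this
      simp at hpβα
    · intro δ hδ
      have h5 := pairingIn_eq_neg_one α δ β (by rw [hδ, rα]; abel)
      have h6 := RootPairing.pairing_eq_add_of_root_eq_add (l := α) hδ
      have h2 : ∀ x y, (rootSystem H).pairing x y = (((rootSystem H).pairingIn ℤ x y : ℤ) : ℂ) :=
        fun x y => by simpa using ((rootSystem H).algebraMap_pairingIn ℤ x y).symm
      rw [RootPairing.pairing_reflectionPerm_self_left, RootPairing.pairing_same, h2, h2, h5,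
        hpβα] at h6
      norm_num at h6
  have hsq : c * c = 1 := by
    have J := leibniz_lie (B.e α) (B.e β) (B.e nα)
    have hl : ⁅B.e β, ((rootSystem H).coroot α : 𝔤)⁆ = B.e β := by
      rw [← lie_skew, B.lie_h_e, hpβα]
      simp
    rw [hzero, lie_zero, hc, smul_lie, hd, tα, hl] at J
    have J' : (1 - c * c) • B.e β = 0 := by
      rw [sub_smul, one_smul, mul_smul, J]
      module
    have := (smul_eq_zero.1 J').resolve_right (B.e_ne_zero β)
    linear_combination -this
  rcases mul_self_eq_one_iff.1 hsq with h | h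
  · left
    rw [hc, h, one_smul]
  · right
    rw [hc, h, neg_one_smul]

/-- The integral span of the Chevalley basis, a Lie algebra over `ℤ`. -/
def integralForm : LieSubalgebra ℤ 𝔤 where
  __ := Submodule.span ℤ (Set.range B.h ∪ Set.range B.e)
  lie_mem' := by
    have hh : ∀ i, B.h i ∈ Submodule.span ℤ (Set.range B.h ∪ Set.range B.e) :=
      fun i => Submodule.subset_span (Or.inl ⟨i, rfl⟩)
    have he : ∀ α, B.e α ∈ Submodule.span ℤ (Set.range B.h ∪ Set.range B.e) :=
      fun α => Submodule.subset_span (Or.inr ⟨α, rfl⟩)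
    have hcor : ∀ α, ((rootSystem H).coroot α : 𝔤) ∈
        Submodule.span ℤ (Set.range B.h ∪ Set.range B.e) := by
      intro α
      have h1 := B.base.coroot_mem_span_int α
      have h2 := Submodule.mem_map_of_mem
        (f := (H.toSubmodule.subtype.toAddMonoidHom.toIntLinearMap)) h1
      rw [Submodule.map_span] at h2
      refine Submodule.span_mono ?_ h2
      rintro _ ⟨_, ⟨i, hi, rfl⟩, rfl⟩
      exact Or.inl ⟨⟨i, hi⟩, rfl⟩
    intro x y hx hy
    change x ∈ Submodule.span ℤ _ at hx
    change y ∈ Submodule.span ℤ _ at hy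
    change ⁅x, y⁆ ∈ Submodule.span ℤ _
    induction hx, hy using Submodule.span_induction₂ with
    | mem_mem x y hx hy =>
      rcases hx with ⟨i, rfl⟩ | ⟨α, rfl⟩ <;> rcases hy with ⟨j, rfl⟩ | ⟨β, rfl⟩
      · have h0 : ⁅(rootSystem H).coroot i, (rootSystem H).coroot j⁆ = 0 := trivial_lie_zero _ _ _ _
        have : ⁅B.h i, B.h j⁆ = 0 := congrArg Subtype.val h0
        rw [this]
        exact zero_mem _
      · rw [show B.h i = ((rootSystem H).coroot i : 𝔤) from rfl, B.lie_h_e]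
        exact Submodule.smul_mem _ _ (he β)
      · rw [← lie_skew, show B.h j = ((rootSystem H).coroot j : 𝔤) from rfl, B.lie_h_e]
        exact neg_mem (Submodule.smul_mem _ _ (he α))
      · by_cases h0 : (rootSystem H).root α + (rootSystem H).root β = 0
        · have : β = negRoot (rootSystem H) α := by
            apply (rootSystem H).root.injective
            rw [root_negRoot]
            exact (neg_eq_of_add_eq_zero_right h0).symm
          rw [this, B.lie_e_e_neg]
          exact hcor α
        · by_cases h1 : ∃ γ, (rootSystem H).root γ =
              (rootSystem H).root α + (rootSystem H).root β
          · obtain ⟨γ, hγ⟩ := h1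
            rcases B.lie_e_e_eq_or α β γ hγ with h | h
            · rw [h]
              exact he γ
            · rw [h]
              exact neg_mem (he γ)
          · push Not at h1
            rw [B.lie_e_e_eq_zero α β h0 h1]
            exact zero_mem _
    | zero_left y _ => simp
    | zero_right x _ => simp
    | add_left x y z _ _ _ h1 h2 => rw [add_lie]; exact add_mem h1 h2
    | add_right x y z _ _ _ h1 h2 => rw [lie_add]; exact add_mem h1 h2
    | smul_left r x y _ _ h => rw [smul_lie]; exact Submodule.smul_mem _ _ h
    | smul_right r x y _ _ h => rw [lie_smul]; exact Submodule.smul_mem _ _ h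

lemma h_mem (i : B.base.support) : B.h i ∈ B.integralForm :=
  Submodule.subset_span (Or.inl ⟨i, rfl⟩)

lemma e_mem_integralForm (α : H.root) : B.e α ∈ B.integralForm :=
  Submodule.subset_span (Or.inr ⟨α, rfl⟩)

/-- The Chevalley algebra `L(Φ, R)` over a commutative ring `R`. -/
abbrev algebra (R : Type*) [CommRing R] : Type _ := R ⊗[ℤ] B.integralForm

variable (R : Type*) [CommRing R]

/-- The basis element `h_i` in `L(Φ, R)`. -/
def hR (i : B.base.support) : B.algebra R := 1 ⊗ₜ ⟨B.h i, B.h_mem i⟩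

/-- The basis element `e_α` in `L(Φ, R)`. -/
def eR (α : H.root) : B.algebra R := 1 ⊗ₜ ⟨B.e α, B.e_mem_integralForm α⟩

/-- The toric subalgebra `D`, spanned by the commuting elements `h_i`. -/
def D : Submodule R (B.algebra R) := Submodule.span R (Set.range (B.hR R))

variable (Δ : Set H.root)

/-- The module `M_[γ]`, spanned by the root vectors of the roots in the block. -/
def M (q : Block (rootSystem H) Δ) : Submodule R (B.algebra R) :=
  Submodule.span R (B.eR R '' {γ | block (rootSystem H) Δ γ = q})

/-- The subalgebra `L'(Δ, R)` generated by the `e_α` with `α ∈ Δ`. -/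
def subsystemAlgebra : LieSubalgebra R (B.algebra R) :=
  LieSubalgebra.lieSpan R (B.algebra R) (B.eR R '' Δ)

/-- The level of a subalgebra: `lev(L)_[γ] = M_[γ] ∩ L`. -/
def lev (L : LieSubalgebra R (B.algebra R)) (q : Block (rootSystem H) Δ) :
    Submodule R (B.algebra R) :=
  B.M R Δ q ⊓ L.toSubmodule

variable {R Δ}

/-- Prelevels. The last two conditions are
`σ_{[γ]+α} = T_{[γ] → [γ]+α}(σ_[γ])` whenever `([γ], α) = -1`, where `T` is the restriction of
`ad e_α`, and `σ_[α] = M_[α]`, for all `α ∈ Δ`. -/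
structure IsPrelevel (σ : Block (rootSystem H) Δ → Submodule R (B.algebra R)) : Prop where
  le_M : ∀ q, σ q ≤ B.M R Δ q
  map_ad : ∀ α ∈ Δ, ∀ γ γ' : H.root, (rootSystem H).pairingIn ℤ γ α = -1 →
    (rootSystem H).root γ' = (rootSystem H).root γ + (rootSystem H).root α →
    σ (block (rootSystem H) Δ γ') =
      (σ (block (rootSystem H) Δ γ)).map (LieAlgebra.ad R (B.algebra R) (B.eR R α))
  eq_M : ∀ α ∈ Δ, σ (block (rootSystem H) Δ α) = B.M R Δ (block (rootSystem H) Δ α)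

/-- The `R`-overalgebras of `L'(Δ, R)` of level `σ`. -/
def overalgebras (σ : Block (rootSystem H) Δ → Submodule R (B.algebra R)) :
    Set (LieSubalgebra R (B.algebra R)) :=
  {L | B.subsystemAlgebra R Δ ≤ L ∧ B.lev R Δ L = σ}

/-- A prelevel is an almost level if it is the level of some overalgebra of `L'(Δ, R)`. -/
def IsAlmostLevel (σ : Block (rootSystem H) Δ → Submodule R (B.algebra R)) : Prop :=
  B.IsPrelevel σ ∧ ∃ L : LieSubalgebra R (B.algebra R), L ∈ B.overalgebras σ

/-- The summands `D ∩ L` (at `none`) and `lev(L)_[γ]` (at `some [γ]`) of the decomposition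
of `L`. -/
def gradedPart (Δ : Set H.root) (L : LieSubalgebra R (B.algebra R)) :
    Option (Block (rootSystem H) Δ) → Submodule R (B.algebra R)
  | none => B.D R ⊓ L.toSubmodule
  | some q => B.lev R Δ L q

end ChevalleyBasis

end ChevalleyBases

end Chevalley

end

open Chevalley LieAlgebra.IsKilling

/-!
The Chevalley algebra `L(Φ, R)` has the `h_i` and `e_γ` as an `R`-basis. For a root `α`, each basis
vector has an integral weight: `0` for `h_i` and `(γ, α)` for `e_γ`. The point is that every
subalgebra `L` containing `e_α` and `e_{-α}` is stable under the projections to the `α`-weight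
spaces, over any ring `R` (`weightProj_mem`). The action of the toric element `h_α` does not show
this, since distinct weights may coincide in `R`. Instead, one uses that the weights `±2` occur
only at `e_{±α}`, which lie in `L`, and that for a vector `v` without component in weight `-2`
the bracket `[e_α, v]` is `[e_α, v₋₁]` up to a multiple of `e_α`, while `[e_{-α}, [e_α, v₋₁]] = v₋₁`.

If `L` contains all `e_α` with `α ∈ Δ`, then `L` is therefore stable under the projections to
the joint weight spaces for `Δ`. The condition `(*)` says in particular that no root is orthogonal
to `Δ`, so that these joint weight spaces are precisely `D` (weight zero) and the `M_[γ]`.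
This is the direct sum decomposition of `L` (`iSup_summand_inf`, `iSupIndep_summand`).

The smallest overalgebra of level `σ` is generated by the `σ_[γ]`. For the largest one, the
decomposition shows that two overalgebras of the same level normalize each other
(`le_normalizer_of_level_eq`): the toric part of the first acts on each `M_[γ]` diagonally and
preserves the common level, and the rest of it lies in the second. On the other hand, passing from
`L` to its normalizer does not change the level (`summand_inf_normalizer`): if `v ∈ M_[γ]`
normalizes `L`, choose `α ∈ Δ` with `([γ], α) < 0`; then either `[γ] = {-α}`, or
`v = [e_{-α}, [e_α, v]]` lies in `L`.
-/

noncomputable section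

namespace Chevalley

section RootSystems

/-! ### Weights of roots in a simply laced system -/

variable {ι K V W : Type*} [Field K] [CharZero K] [AddCommGroup V] [Module K V]
  [AddCommGroup W] [Module K W] {P : RootPairing ι K V W} [P.IsCrystallographic]

lemma pairingIn_negRoot_right (γ α : ι) :
    P.pairingIn ℤ γ (negRoot P α) = -P.pairingIn ℤ γ α := by
  simp

lemma pairingIn_negRoot_self (α : ι) : P.pairingIn ℤ (negRoot P α) α = -2 := by
  simp

omit [CharZero K] [P.IsCrystallographic] in
lemma IsSubsystem.negRoot_mem {Δ : Set ι} (hΔ : IsSubsystem P Δ) {α : ι} (hα : α ∈ Δ) :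
    negRoot P α ∈ Δ :=
  hΔ α hα α hα

/-- Under condition `(*)` no root is orthogonal to `Δ`. -/
lemma ConditionStar.exists_pairingIn_ne_zero {Δ : Set ι}
    (hstar : ConditionStar P Δ) (γ : ι) : ∃ α ∈ Δ, P.pairingIn ℤ γ α ≠ 0 := by
  by_contra! h
  have hγ : γ ∉ Δ := fun hγ => by simpa using h γ hγ
  have hnγ : negRoot P γ ∉ Δ := fun hnγ => by simpa using h _ hnγ
  refine hstar.1 {γ, negRoot P γ} ⟨γ, rfl⟩ ⟨?_, ?_⟩
  · ext β
    simp only [Set.mem_inter_iff, Set.mem_insert_iff, Set.mem_singleton_iff,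
      Set.mem_empty_iff_false, iff_false, not_and, not_or]
    exact fun hβ => ⟨fun h => hγ (h ▸ hβ), fun h => hnγ (h ▸ hβ)⟩
  · rintro α ⟨hα, -⟩ β hβ
    have h0 : P.pairingIn ℤ α γ = 0 := (P.pairingIn_eq_zero_iff).2 (h α hα)
    rcases hβ with rfl | rfl
    · exact h0
    · rw [pairingIn_negRoot_right, h0, neg_zero]

omit [CharZero K] in
lemma block_eq_iff {Δ : Set ι} {γ₁ γ₂ : ι} :
    block P Δ γ₁ = block P Δ γ₂ ↔ ∀ α ∈ Δ, P.pairingIn ℤ γ₁ α = P.pairingIn ℤ γ₂ α :=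
  Quotient.eq

variable [IsSimplyLaced P]

lemma eq_negRoot_of_pairingIn_eq_neg_two {γ α : ι} (h : P.pairingIn ℤ γ α = -2) :
    γ = negRoot P α := by
  by_contra h2
  by_cases h1 : γ = α
  · rw [h1, P.pairingIn_same] at h
    omega
  · rcases IsSimplyLaced.pairingIn_mem (P := P) γ α h1 h2 with h | h | h <;> omega

lemma pairingIn_cases (γ α : ι) :
    P.pairingIn ℤ γ α = -2 ∨ P.pairingIn ℤ γ α = -1 ∨ P.pairingIn ℤ γ α = 0 ∨
      P.pairingIn ℤ γ α = 1 ∨ P.pairingIn ℤ γ α = 2 := by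
  by_cases h1 : γ = α
  · simp [h1]
  by_cases h2 : γ = negRoot P α
  · left
    rw [h2, pairingIn_negRoot_self]
  · rcases IsSimplyLaced.pairingIn_mem (P := P) γ α h1 h2 with h | h | h <;> simp [h]

/-- Under condition `(*)` every root has negative inner product with some root in `Δ`. -/
lemma ConditionStar.exists_pairingIn_neg {Δ : Set ι} (hΔ : IsSubsystem P Δ)
    (hstar : ConditionStar P Δ) (γ : ι) :
    ∃ α ∈ Δ, P.pairingIn ℤ γ α = -1 ∨ P.pairingIn ℤ γ α = -2 := by
  obtain ⟨α, hα, h⟩ := hstar.exists_pairingIn_ne_zero γ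
  have hn := pairingIn_negRoot_right (P := P) γ α
  rcases pairingIn_cases (P := P) γ α with h1 | h1 | h1 | h1 | h1
  · exact ⟨α, hα, Or.inr h1⟩
  · exact ⟨α, hα, Or.inl h1⟩
  · exact absurd h1 h
  · exact ⟨_, hΔ.negRoot_mem hα, Or.inl (by omega)⟩
  · exact ⟨_, hΔ.negRoot_mem hα, Or.inr (by omega)⟩

end RootSystems

/-! ### Lie algebras with a Chevalley basis over an arbitrary ring -/

/-- A basis of a Lie algebra over `R`, consisting of elements `h_i` (with index `inl i`, standing
for the coroot of `s i`) and `e_γ` (with index `inr γ`), is of Chevalley type for the root system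
`P` if it satisfies those of the relations of a Chevalley basis that do not involve signs:
the `h_i` commute and act on `e_γ` by `(γ, s i)`; the product of `e_α` and `e_γ` vanishes if
`(γ, α) ≥ 0`; and `ad e_{-α}` inverts `ad e_α` on `e_γ` if `(γ, α) = -1`. -/
structure IsChevalleyType {ι K V W : Type*} [Field K] [CharZero K] [AddCommGroup V] [Module K V]
    [AddCommGroup W] [Module K W] (P : RootPairing ι K V W) [P.IsCrystallographic]
    {R A I : Type*} [CommRing R] [LieRing A] [LieAlgebra R A] (s : I → ι)
    (b : Module.Basis (I ⊕ ι) R A) : Prop where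
  lie_h_h : ∀ i j, ⁅b (Sum.inl i), b (Sum.inl j)⁆ = 0
  lie_h_e : ∀ i γ, ⁅b (Sum.inl i), b (Sum.inr γ)⁆ = P.pairingIn ℤ γ (s i) • b (Sum.inr γ)
  lie_e_e_eq_zero : ∀ α γ, 0 ≤ P.pairingIn ℤ γ α → ⁅b (Sum.inr α), b (Sum.inr γ)⁆ = 0
  lie_e_neg_lie_e : ∀ α γ, P.pairingIn ℤ γ α = -1 →
    ⁅b (Sum.inr (negRoot P α)), ⁅b (Sum.inr α), b (Sum.inr γ)⁆⁆ = b (Sum.inr γ)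

/-! ### Projections along a basis -/

section Proj

variable {R A X : Type*} [CommRing R] [AddCommGroup A] [Module R A] (b : Module.Basis X R A)

/-- A linear map takes values in `N` if it maps a basis into `N`. -/
lemma mem_of_forall_basis_mem {f : A →ₗ[R] A} {N : Submodule R A} (h : ∀ i, f (b i) ∈ N) (v : A) :
    f v ∈ N := by
  have h1 : Submodule.span R (Set.range b) ≤ N.comap f := by
    rw [Submodule.span_le]
    rintro _ ⟨i, rfl⟩
    exact h i
  rw [b.span_eq] at h1
  exact h1 Submodule.mem_top

open Classical in
/-- The projection to the span of the basis vectors with index in `T`, along the span of the other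
basis vectors. -/
def proj (T : Set X) : A →ₗ[R] A :=
  b.constr R fun i => if i ∈ T then b i else 0

lemma proj_basis_of_mem {T : Set X} {i : X} (h : i ∈ T) : proj b T (b i) = b i := by
  rw [proj, Module.Basis.constr_basis, if_pos h]

lemma proj_basis_of_notMem {T : Set X} {i : X} (h : i ∉ T) : proj b T (b i) = 0 := by
  rw [proj, Module.Basis.constr_basis, if_neg h]

lemma proj_mem_span (T : Set X) (v : A) : proj b T v ∈ Submodule.span R (b '' T) := by
  refine mem_of_forall_basis_mem b (fun i => ?_) v
  by_cases h : i ∈ T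
  · rw [proj_basis_of_mem b h]
    exact Submodule.subset_span ⟨i, h, rfl⟩
  · rw [proj_basis_of_notMem b h]
    exact zero_mem _

lemma proj_inter (T T' : Set X) : proj b (T ∩ T') = proj b T ∘ₗ proj b T' := by
  refine b.ext fun i => ?_
  by_cases h : i ∈ T <;> by_cases h' : i ∈ T' <;>
    simp [proj_basis_of_mem, proj_basis_of_notMem, h, h']

lemma proj_univ : proj b Set.univ = LinearMap.id :=
  b.ext fun i => proj_basis_of_mem b (Set.mem_univ i)

/-- A vector is the sum of its components for a partition of the basis. -/
lemma sum_proj_preimage {J : Type*} [Fintype J] (f : X → J) :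
    ∑ j, proj b (f ⁻¹' {j}) = LinearMap.id := by
  classical
  refine b.ext fun i => ?_
  rw [LinearMap.sum_apply, Finset.sum_eq_single (f i),
    proj_basis_of_mem b (T := f ⁻¹' {f i}) rfl, LinearMap.id_apply]
  · exact fun j _ hj => proj_basis_of_notMem b fun h => hj h.symm
  · exact fun h => absurd (Finset.mem_univ _) h

end Proj

/-! ### Projections to weight spaces -/

section Weights

variable {ι K V W : Type*} [Field K] [CharZero K] [AddCommGroup V] [Module K V]
  [AddCommGroup W] [Module K W] (P : RootPairing ι K V W) [P.IsCrystallographic]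
  {R A I : Type*} [CommRing R] [LieRing A] [LieAlgebra R A] {s : I → ι}
  (b : Module.Basis (I ⊕ ι) R A)

/-- The weight of a basis vector for the coroot of `α`. -/
def wt (α : ι) : I ⊕ ι → ℤ :=
  Sum.elim (fun _ => 0) fun γ => P.pairingIn ℤ γ α

lemma wt_negRoot (α : ι) (i : I ⊕ ι) : wt P (negRoot P α) i = -wt P α i := by
  rcases i with i | γ
  · simp [wt]
  · exact pairingIn_negRoot_right γ α

lemma wt_cases [IsSimplyLaced P] (α : ι) (i : I ⊕ ι) :
    wt P α i = -2 ∨ wt P α i = -1 ∨ wt P α i = 0 ∨ wt P α i = 1 ∨ wt P α i = 2 := by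
  rcases i with i | γ
  · simp [wt]
  · exact pairingIn_cases γ α

/-- The projection to the weight space of weight `k` for the coroot of `α`. -/
def weightProj (α : ι) (k : ℤ) : A →ₗ[R] A :=
  proj b {i | wt P α i = k}

omit [CharZero K] in
lemma weightProj_basis (α : ι) (k : ℤ) (i : I ⊕ ι) :
    weightProj P b α k (b i) = if wt P α i = k then b i else 0 := by
  split_ifs with h
  · exact proj_basis_of_mem b h
  · exact proj_basis_of_notMem b h

lemma weightProj_negRoot (α : ι) (k : ℤ) :
    weightProj P b (negRoot P α) k = weightProj P b α (-k) := by
  simp only [weightProj, wt_negRoot, neg_eq_iff_eq_neg]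

variable [IsSimplyLaced P]

lemma weightProj_zero (α : ι) (v : A) :
    weightProj P b α 0 v = v - weightProj P b α (-2) v - weightProj P b α (-1) v
      - weightProj P b α 1 v - weightProj P b α 2 v := by
  suffices h : weightProj P b α 0 = LinearMap.id - weightProj P b α (-2) - weightProj P b α (-1)
      - weightProj P b α 1 - weightProj P b α 2 from LinearMap.congr_fun h v
  refine b.ext fun i => ?_
  rcases wt_cases P α i with h | h | h | h | h <;> simp [weightProj_basis, h]

/-- The weight space of weight `-2` for `α` is spanned by `e_{-α}`. -/
lemma weightProj_neg_two_mem_span (α : ι) (v : A) :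
    weightProj P b α (-2) v ∈ Submodule.span R {b (Sum.inr (negRoot P α))} := by
  refine Submodule.span_mono ?_ (proj_mem_span b _ v)
  rintro _ ⟨i | γ, hi, rfl⟩
  · simp [wt] at hi
  · rw [eq_negRoot_of_pairingIn_eq_neg_two (α := α) hi]
    rfl

variable {P b}

/-- Apart from the components of weight `-2` and `-1`, the operator `ad e_α` takes values in
`R e_α`. -/
lemma IsChevalleyType.lie_sub_weightProj_mem_span (hb : IsChevalleyType P s b) (α : ι) (v : A) :
    ⁅b (Sum.inr α), v - weightProj P b α (-2) v - weightProj P b α (-1) v⁆ ∈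
      Submodule.span R {b (Sum.inr α)} := by
  refine mem_of_forall_basis_mem b (f := LieAlgebra.ad R A (b (Sum.inr α)) ∘ₗ
    (LinearMap.id - weightProj P b α (-2) - weightProj P b α (-1))) (fun i => ?_) v
  simp only [LinearMap.comp_apply, LinearMap.sub_apply, LinearMap.id_apply, LieAlgebra.ad_apply,
    weightProj_basis]
  rcases i with i | γ
  · have h : wt P α (Sum.inl i : I ⊕ ι) = 0 := rfl
    rw [h, if_neg (by norm_num), if_neg (by norm_num), sub_zero, sub_zero, ← lie_skew, hb.lie_h_e]
    exact neg_mem (zsmul_mem (Submodule.mem_span_singleton_self _) _)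
  · rcases wt_cases P α (Sum.inr γ : I ⊕ ι) with h | h | h
    · simp [h]
    · simp [h]
    · have h' : 0 ≤ wt P α (Sum.inr γ : I ⊕ ι) := by omega
      rw [if_neg (by omega), if_neg (by omega), sub_zero, sub_zero, hb.lie_e_e_eq_zero α γ h']
      exact zero_mem _

omit [IsSimplyLaced P] in
lemma IsChevalleyType.lie_neg_lie_weightProj (hb : IsChevalleyType P s b) (α : ι) (v : A) :
    ⁅b (Sum.inr (negRoot P α)), ⁅b (Sum.inr α), weightProj P b α (-1) v⁆⁆ =
      weightProj P b α (-1) v := by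
  suffices h : LieAlgebra.ad R A (b (Sum.inr (negRoot P α))) ∘ₗ
      LieAlgebra.ad R A (b (Sum.inr α)) ∘ₗ weightProj P b α (-1) =
        weightProj P b α (-1) from LinearMap.congr_fun h v
  refine b.ext fun i => ?_
  simp only [LinearMap.comp_apply, LieAlgebra.ad_apply, weightProj_basis]
  split_ifs with h
  · rcases i with i | γ
    · simp [wt] at h
    · exact hb.lie_e_neg_lie_e α γ h
  · simp

variable {L : LieSubalgebra R A} {α : ι}

lemma weightProj_neg_two_mem (h' : b (Sum.inr (negRoot P α)) ∈ L) (v : A) :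
    weightProj P b α (-2) v ∈ L :=
  (Submodule.span_singleton_le_iff_mem _ L.toSubmodule).2 h' (weightProj_neg_two_mem_span P b α v)

lemma IsChevalleyType.weightProj_neg_one_mem (hb : IsChevalleyType P s b)
    (h : b (Sum.inr α) ∈ L) (h' : b (Sum.inr (negRoot P α)) ∈ L) {v : A} (hv : v ∈ L) :
    weightProj P b α (-1) v ∈ L := by
  rw [← hb.lie_neg_lie_weightProj]
  refine L.lie_mem h' ?_
  have h1 : ⁅b (Sum.inr α), v - weightProj P b α (-2) v⁆ ∈ L :=
    L.lie_mem h (sub_mem hv (weightProj_neg_two_mem h' v))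
  have h2 : ⁅b (Sum.inr α), v - weightProj P b α (-2) v - weightProj P b α (-1) v⁆ ∈ L :=
    (Submodule.span_singleton_le_iff_mem _ L.toSubmodule).2 h
      (hb.lie_sub_weightProj_mem_span α v)
  rw [lie_sub] at h2
  have h3 := sub_mem h1 h2
  rwa [sub_sub_cancel] at h3

/-- A subalgebra that contains `e_α` and `e_{-α}` is stable under the projections to the weight
spaces for `α`. -/
lemma IsChevalleyType.weightProj_mem (hb : IsChevalleyType P s b)
    (h : b (Sum.inr α) ∈ L) (h' : b (Sum.inr (negRoot P α)) ∈ L) (k : ℤ) {v : A} (hv : v ∈ L) :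
    weightProj P b α k v ∈ L := by
  have hneg2 := weightProj_neg_two_mem h' v
  have hneg1 := hb.weightProj_neg_one_mem h h' hv
  have hnn : negRoot P (negRoot P α) = α := by
    apply P.root.injective
    rw [P.root_reflectionPerm, P.reflection_apply_self, P.root_reflectionPerm,
      P.reflection_apply_self, neg_neg]
  -- The positive weights for `α` are the negative weights for `-α`.
  have h'' : b (Sum.inr (negRoot P (negRoot P α))) ∈ L := by rwa [hnn]
  have h2 := weightProj_neg_two_mem h'' v
  have h1 := hb.weightProj_neg_one_mem h' h'' hv
  rw [weightProj_negRoot, neg_neg] at h1 h2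
  have h0 : weightProj P b α 0 v ∈ L := by
    rw [weightProj_zero]
    exact sub_mem (sub_mem (sub_mem (sub_mem hv hneg2) hneg1) h1) h2
  by_cases hk : k = -2 ∨ k = -1 ∨ k = 0 ∨ k = 1 ∨ k = 2
  · rcases hk with rfl | rfl | rfl | rfl | rfl <;> assumption
  · have : weightProj P b α k = 0 := by
      refine b.ext fun i => ?_
      have := wt_cases P α i
      rw [weightProj_basis, if_neg (by rintro rfl; exact hk this), LinearMap.zero_apply]
    rw [this]
    exact zero_mem _

/-! ### The decomposition of subalgebras -/

variable {Δ : Set ι}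

/-- A subalgebra that contains `e_α` for all `α ∈ Δ` is stable under the projections to the joint
weight spaces for `Δ`. -/
lemma IsChevalleyType.proj_joint_weight_mem [Finite ι] (hb : IsChevalleyType P s b)
    (hΔ : IsSubsystem P Δ) (hL : ∀ α ∈ Δ, b (Sum.inr α) ∈ L)
    (w : ι → ℤ) {v : A} (hv : v ∈ L) :
    proj b {i | ∀ α ∈ Δ, wt P α i = w α} v ∈ L := by
  suffices h : ∀ S : Finset ι, ↑S ⊆ Δ → proj b {i | ∀ α ∈ S, wt P α i = w α} v ∈ L by
    obtain ⟨S, hS⟩ := (Set.toFinite Δ).exists_finset_coe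
    have := h S hS.le
    simpa only [← Finset.mem_coe, hS] using this
  intro S
  classical
  induction S using Finset.induction_on with
  | empty => intro _; simpa [proj_univ] using hv
  | insert α S _ ih =>
    intro hS
    rw [Finset.coe_insert, Set.insert_subset_iff] at hS
    have h1 : {i | ∀ β ∈ insert α S, wt P β i = w β} =
        {i : I ⊕ ι | wt P α i = w α} ∩ {i | ∀ β ∈ S, wt P β i = w β} := by
      ext i
      simp
    rw [h1, proj_inter]
    exact hb.weightProj_mem (hL α hS.1) (hL _ (hΔ.negRoot_mem hS.1)) _ (ih hS.2)

variable (P Δ) in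
/-- The index of the summand of the decomposition in which a basis vector lies: `none` for `h_i`
and the block of `γ` for `e_γ`. -/
def part : I ⊕ ι → Option (Block P Δ) :=
  Sum.elim (fun _ => none) fun γ => some (block P Δ γ)

variable (P Δ b) in
/-- The span of the `h_i` (at `none`) and the modules `M_[γ]` (at `some [γ]`). -/
def summand (j : Option (Block P Δ)) : Submodule R A :=
  Submodule.span R (b '' (part P Δ ⁻¹' {j}))

omit [IsSimplyLaced P] in
/-- The fibres of `part` are the joint weight spaces for `Δ`: since no root is orthogonal to `Δ`,
the toric part is the joint weight space of weight zero. -/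
lemma exists_part_preimage_eq (hstar : ConditionStar P Δ) (j : Option (Block P Δ)) :
    ∃ w : ι → ℤ, part P Δ ⁻¹' {j} = {i : I ⊕ ι | ∀ α ∈ Δ, wt P α i = w α} := by
  rcases j with _ | q
  · refine ⟨0, Set.ext fun i => ?_⟩
    rcases i with i | γ
    · simp [part, wt]
    · obtain ⟨α, hα, h⟩ := hstar.exists_pairingIn_ne_zero γ
      simp only [part, wt, Set.mem_preimage, Sum.elim_inr, Set.mem_singleton_iff, reduceCtorEq,
        false_iff, Set.mem_ofPred_eq]
      exact fun h' => h (h' α hα)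
  · obtain ⟨γ₀, rfl⟩ := Quotient.exists_rep q
    refine ⟨fun α => P.pairingIn ℤ γ₀ α, Set.ext fun i => ?_⟩
    rcases i with i | γ
    · obtain ⟨α, hα, h⟩ := hstar.exists_pairingIn_ne_zero γ₀
      simp only [part, wt, Set.mem_preimage, Sum.elim_inl, Set.mem_singleton_iff, reduceCtorEq,
        false_iff, Set.mem_ofPred_eq]
      exact fun h' => h (h' α hα).symm
    · simp only [part, wt, Set.mem_preimage, Sum.elim_inr, Set.mem_singleton_iff,
        Option.some.injEq, Set.mem_ofPred_eq]
      exact block_eq_iff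

omit [CharZero K] [IsSimplyLaced P] in
variable (P b Δ) in
lemma iSupIndep_summand : iSupIndep (summand P b Δ) := by
  intro j
  refine (b.linearIndependent.disjoint_span_image (t := (part P Δ ⁻¹' {j})ᶜ)
    disjoint_compl_right).mono_right (iSup₂_le fun j' hj' => ?_)
  exact Submodule.span_mono (Set.image_mono fun i hi hi' => hj' (hi.symm.trans hi'))

lemma IsChevalleyType.iSup_summand_inf [Finite ι] (hb : IsChevalleyType P s b)
    (hΔ : IsSubsystem P Δ) (hstar : ConditionStar P Δ) (hL : ∀ α ∈ Δ, b (Sum.inr α) ∈ L) :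
    ⨆ j, summand P b Δ j ⊓ L.toSubmodule = L.toSubmodule := by
  refine le_antisymm (iSup_le fun j => inf_le_right) fun v hv => ?_
  have : Fintype (Option (Block P Δ)) := Fintype.ofFinite _
  rw [← LinearMap.id_apply (R := R) v, ← sum_proj_preimage b (part P Δ), LinearMap.sum_apply]
  refine sum_mem fun j _ => Submodule.mem_iSup_of_mem j ⟨proj_mem_span b _ v, ?_⟩
  obtain ⟨w, hw⟩ := exists_part_preimage_eq (I := I) hstar j
  rw [hw]
  exact hb.proj_joint_weight_mem hΔ hL w hv

/-! ### Normalizers of subalgebras -/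

omit [IsSimplyLaced P] in
lemma IsChevalleyType.lie_toric_toric (hb : IsChevalleyType P s b) {x y : A}
    (hx : x ∈ summand P b Δ none) (hy : y ∈ summand P b Δ none) : ⁅x, y⁆ = 0 := by
  induction hx, hy using Submodule.span_induction₂ with
  | mem_mem x y hx hy =>
    obtain ⟨i | γ, hi, rfl⟩ := hx
    · obtain ⟨j | γ, hj, rfl⟩ := hy
      · exact hb.lie_h_h i j
      · simp [part] at hj
    · simp [part] at hi
  | zero_left y _ => simp
  | zero_right x _ => simp
  | add_left x y z _ _ _ h1 h2 => rw [add_lie, h1, h2, add_zero]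
  | add_right x y z _ _ _ h1 h2 => rw [lie_add, h1, h2, add_zero]
  | smul_left r x y _ _ h => rw [smul_lie, h, smul_zero]
  | smul_right r x y _ _ h => rw [lie_smul, h, smul_zero]

omit [IsSimplyLaced P] in
lemma IsChevalleyType.lie_toric_block (hb : IsChevalleyType P s b) {q : Block P Δ} {x y : A}
    (hx : x ∈ summand P b Δ none) (hy : y ∈ summand P b Δ (some q)) :
    ⁅x, y⁆ ∈ summand P b Δ (some q) := by
  induction hx, hy using Submodule.span_induction₂ with
  | mem_mem x y hx hy =>
    obtain ⟨i | γ, hi, rfl⟩ := hx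
    · obtain ⟨j | γ, hj, rfl⟩ := hy
      · simp [part] at hj
      · rw [hb.lie_h_e]
        have h : b (Sum.inr γ) ∈ summand P b Δ (some q) := Submodule.subset_span ⟨_, hj, rfl⟩
        exact zsmul_mem h _
    · simp [part] at hi
  | zero_left y _ => simp
  | zero_right x _ => simp
  | add_left x y z _ _ _ h1 h2 => rw [add_lie]; exact add_mem h1 h2
  | add_right x y z _ _ _ h1 h2 => rw [lie_add]; exact add_mem h1 h2
  | smul_left r x y _ _ h => rw [smul_lie]; exact Submodule.smul_mem _ _ h
  | smul_right r x y _ _ h => rw [lie_smul]; exact Submodule.smul_mem _ _ h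

/-- Subalgebras of the same level normalize each other. -/
lemma IsChevalleyType.le_normalizer_of_level_eq [Finite ι] (hb : IsChevalleyType P s b)
    {L' : LieSubalgebra R A} (hΔ : IsSubsystem P Δ) (hstar : ConditionStar P Δ)
    (hL : ∀ α ∈ Δ, b (Sum.inr α) ∈ L) (hL' : ∀ α ∈ Δ, b (Sum.inr α) ∈ L')
    (hlev : ∀ q, summand P b Δ (some q) ⊓ L'.toSubmodule =
      summand P b Δ (some q) ⊓ L.toSubmodule) : L' ≤ L.normalizer := by
  suffices h : L'.toSubmodule ≤ L.normalizer.toSubmodule from h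
  rw [← hb.iSup_summand_inf hΔ hstar hL']
  refine iSup_le fun j => ?_
  rcases j with _ | q
  · rintro d ⟨hdD, hdL'⟩
    refine (L.mem_normalizer_iff d).2 fun y hy => ?_
    suffices h : L.toSubmodule ≤ L.toSubmodule.comap (LieAlgebra.ad R A d) from h hy
    conv_lhs => rw [← hb.iSup_summand_inf hΔ hstar hL]
    refine iSup_le fun j => ?_
    rcases j with _ | q
    · rintro y ⟨hyD, -⟩
      rw [Submodule.mem_comap, LieAlgebra.ad_apply, hb.lie_toric_toric hdD hyD]
      exact zero_mem _
    · intro y hy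
      rw [← hlev q] at hy
      have hdy : ⁅d, y⁆ ∈ summand P b Δ (some q) ⊓ L'.toSubmodule :=
        ⟨hb.lie_toric_block hdD hy.1, L'.lie_mem hdL' hy.2⟩
      rw [hlev q] at hdy
      exact hdy.2
  · rw [hlev q]
    exact inf_le_right.trans L.le_normalizer

/-- The normalizer of a subalgebra that contains all `e_α` with `α ∈ Δ` has the same level. -/
lemma IsChevalleyType.summand_inf_normalizer (hb : IsChevalleyType P s b)
    (hΔ : IsSubsystem P Δ) (hstar : ConditionStar P Δ) (hL : ∀ α ∈ Δ, b (Sum.inr α) ∈ L)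
    (q : Block P Δ) :
    summand P b Δ (some q) ⊓ L.normalizer.toSubmodule =
      summand P b Δ (some q) ⊓ L.toSubmodule := by
  refine le_antisymm ?_ (inf_le_inf_left _ L.le_normalizer)
  rintro v ⟨hvM, hvN⟩
  refine ⟨hvM, ?_⟩
  obtain ⟨γ₀, rfl⟩ := Quotient.exists_rep q
  have hM : ∀ γ, part (I := I) P Δ (Sum.inr γ) = some (block P Δ γ₀) →
      ∀ α ∈ Δ, P.pairingIn ℤ γ α = P.pairingIn ℤ γ₀ α :=
    fun γ h => block_eq_iff.1 (Option.some_injective _ h)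
  obtain ⟨α, hα, h | h⟩ := hstar.exists_pairingIn_neg hΔ γ₀
  · have hv : ⁅b (Sum.inr (negRoot P α)), ⁅b (Sum.inr α), v⁆⁆ = v := by
      refine LinearMap.eqOn_span (f := LieAlgebra.ad R A (b (Sum.inr (negRoot P α))) ∘ₗ
        LieAlgebra.ad R A (b (Sum.inr α))) (g := LinearMap.id) ?_ hvM
      rintro _ ⟨i | γ, hγ, rfl⟩
      · simp [part] at hγ
      · exact hb.lie_e_neg_lie_e α γ ((hM γ hγ α hα).trans h)
    rw [← hv]
    exact L.lie_mem (hL _ (hΔ.negRoot_mem hα))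
      ((L.mem_normalizer_iff' v).1 hvN _ (hL α hα))
  · refine (Submodule.span_le (p := L.toSubmodule)).2 ?_ hvM
    rintro _ ⟨i | γ, hγ, rfl⟩
    · simp [part] at hγ
    · rw [eq_negRoot_of_pairingIn_eq_neg_two ((hM γ hγ α hα).trans h)]
      exact hL _ (hΔ.negRoot_mem hα)

end Weights

open LieAlgebra LieAlgebra.IsKilling

variable {𝔤 : Type*} [LieRing 𝔤] [LieAlgebra ℂ 𝔤] [FiniteDimensional ℂ 𝔤]
  [LieAlgebra.IsKilling ℂ 𝔤] {H : LieSubalgebra ℂ 𝔤} [H.IsCartanSubalgebra]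

namespace ChevalleyBasis

variable (B : ChevalleyBasis H)

/-! ### The Chevalley basis of the Chevalley algebra -/

lemma linearIndependent_h : LinearIndependent ℂ B.h := by
  have h1 : LinearIndependent ℂ fun i : B.base.support => (rootSystem H).coroot i :=
    B.base.linearIndepOn_coroot
  exact h1.map' H.toSubmodule.subtype (Submodule.ker_subtype _)

omit [LieAlgebra.IsKilling ℂ 𝔤] in
lemma injective_root_weight :
    Function.Injective fun α : H.root => ((α : LieModule.Weight ℂ H 𝔤) : H → ℂ) :=
  fun _ _ h => Subtype.ext (DFunLike.coe_injective h)

omit [FiniteDimensional ℂ 𝔤] [LieAlgebra.IsKilling ℂ 𝔤] in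
lemma iSupIndep_rootSpace :
    iSupIndep fun χ : H → ℂ => (rootSpace H χ).toSubmodule :=
  LieSubmodule.iSupIndep_toSubmodule.2 (LieModule.iSupIndep_genWeightSpace ℂ H 𝔤)

lemma linearIndependent_e : LinearIndependent ℂ B.e :=
  iSupIndep.linearIndependent _ (iSupIndep_rootSpace.comp injective_root_weight)
    B.e_mem B.e_ne_zero

lemma linearIndependent_h_e : LinearIndependent ℂ (Sum.elim B.h B.e) := by
  refine B.linearIndependent_h.sum_type B.linearIndependent_e ?_
  refine (iSupIndep_rootSpace (H := H) 0).mono ?_ ?_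
  · rw [Submodule.span_le]
    rintro _ ⟨i, rfl⟩
    exact toLieSubmodule_le_rootSpace_zero ℂ 𝔤 H ((rootSystem H).coroot i).2
  · rw [Submodule.span_le]
    rintro _ ⟨α, rfl⟩
    have hα : ((α : LieModule.Weight ℂ H 𝔤) : H → ℂ) ≠ 0 := H.isNonZero_coe_root α
    exact Submodule.mem_iSup_of_mem _ (Submodule.mem_iSup_of_mem hα (B.e_mem α))

variable [IsSimplyLaced (rootSystem H)]

/-- The Chevalley basis as a `ℤ`-basis of the integral form. -/
def integralBasis : Module.Basis (B.base.support ⊕ H.root) ℤ B.integralForm :=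
  (Module.Basis.span (B.linearIndependent_h_e.restrict_scalars' ℤ)).map
    (LinearEquiv.ofEq _ B.integralForm.toSubmodule
      (by rw [Set.Sum.elim_range]; rfl))

variable (R : Type*) [CommRing R]

/-- The Chevalley basis of `L(Φ, R)`. -/
def basisR : Module.Basis (B.base.support ⊕ H.root) R (B.algebra R) :=
  B.integralBasis.baseChange R

@[simp] lemma basisR_inl (i : B.base.support) : B.basisR R (Sum.inl i) = B.hR R i := by
  rw [basisR, Module.Basis.baseChange_apply, hR]
  congr 1
  exact Subtype.ext (Module.Basis.coe_span_apply
    (B.linearIndependent_h_e.restrict_scalars' ℤ) _)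

@[simp] lemma basisR_inr (α : H.root) : B.basisR R (Sum.inr α) = B.eR R α := by
  rw [basisR, Module.Basis.baseChange_apply, eR]
  congr 1
  exact Subtype.ext (Module.Basis.coe_span_apply
    (B.linearIndependent_h_e.restrict_scalars' ℤ) _)

/-! ### Brackets of basis elements -/

lemma lie_e_e_eq_zero_of_pairingIn {α γ : H.root} (h : 0 ≤ (rootSystem H).pairingIn ℤ γ α) :
    ⁅B.e α, B.e γ⁆ = 0 := by
  refine B.lie_e_e_eq_zero α γ (fun h0 => ?_) fun β hβ => ?_
  · have : γ = negRoot (rootSystem H) α := by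
      apply (rootSystem H).root.injective
      rw [root_negRoot]
      exact (neg_eq_of_add_eq_zero_right h0).symm
    rw [this, pairingIn_negRoot_self] at h
    omega
  · have := pairingIn_eq_neg_one α γ β hβ
    omega

/-- In weight `-1` for `α`, the operators `ad e_α` and `ad e_{-α}` are mutually inverse. -/
lemma lie_e_neg_lie_e {α γ : H.root} (h : (rootSystem H).pairingIn ℤ γ α = -1) :
    ⁅B.e (negRoot (rootSystem H) α), ⁅B.e α, B.e γ⁆⁆ = B.e γ := by
  have h1 : ⁅B.e (negRoot (rootSystem H) α), B.e γ⁆ = 0 :=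
    B.lie_e_e_eq_zero_of_pairingIn (by rw [pairingIn_negRoot_right]; omega)
  rw [leibniz_lie, h1, lie_zero, add_zero, ← lie_skew (B.e (negRoot _ α)), B.lie_e_e_neg, neg_lie,
    B.lie_h_e, h]
  simp

variable {R} in
lemma tmul_lie_tmul (x y : B.integralForm) :
    ⁅((1 : R) ⊗ₜ[ℤ] x : B.algebra R), ((1 : R) ⊗ₜ[ℤ] y : B.algebra R)⁆ = 1 ⊗ₜ[ℤ] ⁅x, y⁆ := by
  rw [LieAlgebra.ExtendScalars.bracket_tmul, one_mul]

lemma lie_hR_eR (i : B.base.support) (γ : H.root) :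
    ⁅B.hR R i, B.eR R γ⁆ = (rootSystem H).pairingIn ℤ γ i • B.eR R γ := by
  rw [hR, eR, tmul_lie_tmul, ← TensorProduct.tmul_smul]
  congr 1
  exact Subtype.ext (B.lie_h_e i γ)

lemma lie_hR_hR (i j : B.base.support) : ⁅B.hR R i, B.hR R j⁆ = 0 := by
  have h0 : ⁅(rootSystem H).coroot i, (rootSystem H).coroot j⁆ = 0 := trivial_lie_zero _ _ _ _
  have h1 : ⁅B.h i, B.h j⁆ = 0 := congrArg Subtype.val h0
  rw [hR, hR, tmul_lie_tmul, ← TensorProduct.tmul_zero B.integralForm (1 : R)]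
  congr 1
  exact Subtype.ext h1

lemma lie_eR_eR_eq_zero {α γ : H.root} (h : 0 ≤ (rootSystem H).pairingIn ℤ γ α) :
    ⁅B.eR R α, B.eR R γ⁆ = 0 := by
  rw [eR, eR, tmul_lie_tmul, ← TensorProduct.tmul_zero B.integralForm (1 : R)]
  congr 1
  exact Subtype.ext (B.lie_e_e_eq_zero_of_pairingIn h)

lemma lie_eR_neg_lie_eR {α γ : H.root} (h : (rootSystem H).pairingIn ℤ γ α = -1) :
    ⁅B.eR R (negRoot (rootSystem H) α), ⁅B.eR R α, B.eR R γ⁆⁆ = B.eR R γ := by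
  rw [eR, eR, eR, tmul_lie_tmul, tmul_lie_tmul]
  congr 1
  exact Subtype.ext (B.lie_e_neg_lie_e h)

lemma isChevalleyType_basisR :
    IsChevalleyType (rootSystem H) (fun i : B.base.support => (i : H.root)) (B.basisR R) where
  lie_h_h i j := by
    rw [basisR_inl, basisR_inl]
    exact B.lie_hR_hR R i j
  lie_h_e i γ := by
    rw [basisR_inl, basisR_inr]
    exact B.lie_hR_eR R i γ
  lie_e_e_eq_zero α γ h := by
    rw [basisR_inr, basisR_inr]
    exact B.lie_eR_eR_eq_zero R h
  lie_e_neg_lie_e α γ h := by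
    rw [basisR_inr, basisR_inr, basisR_inr]
    exact B.lie_eR_neg_lie_eR R h

/-! ### Overalgebras of a given level -/

variable {R} {Δ : Set H.root} {L : LieSubalgebra R (B.algebra R)}

lemma gradedPart_eq (j : Option (Block (rootSystem H) Δ)) :
    B.gradedPart Δ L j =
      summand (rootSystem H) (B.basisR R) Δ j ⊓ L.toSubmodule := by
  rcases j with _ | q
  · have : B.basisR R '' (part (rootSystem H) Δ ⁻¹' {none}) = Set.range (B.hR R) := by
      ext x
      constructor
      · rintro ⟨i | γ, hi, rfl⟩
        · exact ⟨i, (B.basisR_inl R i).symm⟩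
        · simp [part] at hi
      · rintro ⟨i, rfl⟩
        exact ⟨Sum.inl i, rfl, B.basisR_inl R i⟩
    rw [summand, this]
    rfl
  · have : B.basisR R '' (part (rootSystem H) Δ ⁻¹' {some q}) =
        B.eR R '' {γ | block (rootSystem H) Δ γ = q} := by
      ext x
      constructor
      · rintro ⟨i | γ, hi, rfl⟩
        · simp [part] at hi
        · exact ⟨γ, Option.some_injective _ hi, (B.basisR_inr R γ).symm⟩
      · rintro ⟨γ, rfl, rfl⟩
        exact ⟨Sum.inr γ, rfl, B.basisR_inr R γ⟩
    rw [summand, this]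
    rfl

lemma lev_eq (q : Block (rootSystem H) Δ) :
    B.lev R Δ L q = summand (rootSystem H) (B.basisR R) Δ (some q) ⊓ L.toSubmodule :=
  B.gradedPart_eq (some q)

lemma iSupIndep_gradedPart (Δ : Set H.root) (L : LieSubalgebra R (B.algebra R)) :
    iSupIndep (B.gradedPart Δ L) :=
  (iSupIndep_summand (rootSystem H) (B.basisR R) Δ).mono fun j =>
    (B.gradedPart_eq j).trans_le inf_le_left

lemma subsystemAlgebra_le_iff :
    B.subsystemAlgebra R Δ ≤ L ↔ ∀ α ∈ Δ, B.eR R α ∈ L := by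
  rw [subsystemAlgebra, LieSubalgebra.lieSpan_le, Set.image_subset_iff]
  rfl

lemma basisR_mem (h : B.subsystemAlgebra R Δ ≤ L) : ∀ α ∈ Δ, B.basisR R (Sum.inr α) ∈ L :=
  fun α hα => by
    rw [basisR_inr]
    exact B.subsystemAlgebra_le_iff.1 h α hα

lemma iSup_gradedPart (hΔ : IsSubsystem (rootSystem H) Δ)
    (hstar : ConditionStar (rootSystem H) Δ) (hL : B.subsystemAlgebra R Δ ≤ L) :
    ⨆ j, B.gradedPart Δ L j = L.toSubmodule := by
  simp_rw [gradedPart_eq]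
  exact (B.isChevalleyType_basisR R).iSup_summand_inf hΔ hstar (B.basisR_mem hL)

/-- The subalgebra generated by the `σ_[γ]`; if there are overalgebras of level `σ` at all, it is
the smallest one. -/
def minAlgebra (σ : Block (rootSystem H) Δ → Submodule R (B.algebra R)) :
    LieSubalgebra R (B.algebra R) :=
  LieSubalgebra.lieSpan R (B.algebra R) (⋃ q, σ q)

lemma isLeast_minAlgebra {σ : Block (rootSystem H) Δ → Submodule R (B.algebra R)}
    (hσ : B.IsAlmostLevel σ) : IsLeast (B.overalgebras σ) (B.minAlgebra σ) := by
  have hle : ∀ L ∈ B.overalgebras σ, B.minAlgebra σ ≤ L := by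
    rintro L ⟨-, rfl⟩
    exact LieSubalgebra.lieSpan_le.2 (Set.iUnion_subset fun q x hx => hx.2)
  have hmem : ∀ q, σ q ≤ (B.minAlgebra σ).toSubmodule := fun q x hx =>
    LieSubalgebra.subset_lieSpan (Set.mem_iUnion_of_mem q hx)
  obtain ⟨hpre, L, hL⟩ := hσ
  refine ⟨⟨B.subsystemAlgebra_le_iff.2 fun α hα => ?_, funext fun q => le_antisymm ?_ ?_⟩, hle⟩
  · refine hmem (block (rootSystem H) Δ α) ?_
    rw [hpre.eq_M α hα]
    exact Submodule.subset_span ⟨α, rfl, rfl⟩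
  · rintro x ⟨hxM, hx⟩
    rw [← hL.2]
    exact ⟨hxM, hle L hL hx⟩
  · exact le_inf (hpre.le_M q) (hmem q)

/-- The normalizer of any overalgebra of level `σ` is the largest one. -/
lemma isGreatest_normalizer {σ : Block (rootSystem H) Δ → Submodule R (B.algebra R)}
    (hΔ : IsSubsystem (rootSystem H) Δ) (hstar : ConditionStar (rootSystem H) Δ)
    (hL : L ∈ B.overalgebras σ) : IsGreatest (B.overalgebras σ) L.normalizer := by
  have hL' := B.basisR_mem hL.1
  have hb := B.isChevalleyType_basisR R
  refine ⟨⟨hL.1.trans L.le_normalizer, ?_⟩, fun L' h => ?_⟩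
  · rw [← hL.2]
    funext q
    rw [lev_eq, lev_eq]
    exact hb.summand_inf_normalizer hΔ hstar hL' q
  · refine hb.le_normalizer_of_level_eq hΔ hstar hL' (B.basisR_mem h.1) fun q => ?_
    rw [← lev_eq, ← lev_eq, h.2, hL.2]

end ChevalleyBasis

end Chevalley

end

theorem mainTheorem3 {𝔤 : Type*} [LieRing 𝔤] [LieAlgebra ℂ 𝔤] [FiniteDimensional ℂ 𝔤]
    [LieAlgebra.IsKilling ℂ 𝔤] (H : LieSubalgebra ℂ 𝔤) [H.IsCartanSubalgebra]
    [(rootSystem H).IsIrreducible] [IsSimplyLaced (rootSystem H)]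
    (B : ChevalleyBasis H) (R : Type*) [CommRing R]
    (Δ : Set H.root) (hΔ : IsSubsystem (rootSystem H) Δ)
    (hstar : ConditionStar (rootSystem H) Δ)
    (σ : Block (rootSystem H) Δ → Submodule R (B.algebra R)) (hσ : B.IsAlmostLevel σ) :
    ∃ Lmin Lmax : LieSubalgebra R (B.algebra R),
      IsLeast (B.overalgebras σ) Lmin ∧
      IsGreatest (B.overalgebras σ) Lmax ∧
      (∀ L ∈ B.overalgebras σ, Lmax = L.normalizer) ∧
      (∀ L : LieSubalgebra R (B.algebra R), B.subsystemAlgebra R Δ ≤ L →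
        iSupIndep (B.gradedPart Δ L) ∧ ⨆ j, B.gradedPart Δ L j = L.toSubmodule) := by
  obtain ⟨L₀, hL₀⟩ := hσ.2
  have hmax := B.isGreatest_normalizer hΔ hstar hL₀
  exact ⟨B.minAlgebra σ, L₀.normalizer, B.isLeast_minAlgebra hσ, hmax,
    fun L hL => hmax.unique (B.isGreatest_normalizer hΔ hstar hL),
    fun L hL => ⟨B.iSupIndep_gradedPart Δ L, B.iSup_gradedPart hΔ hstar hL⟩⟩
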